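/- Let $n\ge 0$, let $\Omega$ be an open subset of a real normed space (the parameter space; for instance an open set of Hermitian matrices, or the domain of a local parametrization of the pairs $(D,U)$), and ignore signs in products (wedge products) of differentials. For a differentiable matrix-valued function $M=[m_{ij}]$ on $\Omega$ write $\mathrm dM=[\mathrm dm_{ij}]$ for its matrix of differentials. (a) (Hermitian case.) Let $\lambda_1>\lambda_2>\cdots>\lambda_n$ be differentiable real functions on $\Omega$, $D=\mathrm{diag}(\lambda_1,\ldots,\lambda_n)$, let $U:\Omega\to\mathcal U(n)$ be a differentiable function whose values are unitary matrices with real diagonal entries, and let $X=UDU^*$ (so that $X=[x_{jk}]$ is Hermitian with distinct eigenvalues $\lambda_1>\cdots>\lambda_n$). Put $\mathrm dG_1=U^*\,\mathrm dU$ and $$[\mathrm dX]=\bigwedge_{j}\mathrm dx_{jj}\wedge\bigwedge_{j>k}\mathrm d(\mathrm{Re}\,x_{jk})\wedge \mathrm d(\mathrm{Im}\,x_{jk}),\qquad [\mathrm dD]=\bigwedge_j\mathrm d\lambda_j,\qquad [\mathrm dG_1]=\bigwedge_{i<j}\mathrm{Re}(U^*\mathrm dU)_{ij}\wedge\mathrm{Im}(U^*\mathrm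 dU)_{ij}.$$ Then at every point of $\Omega$, up to sign, $$[\mathrm dX]=\Big(\prod_{j>k}|\lambda_k-\lambda_j|^2\Big)\,[\mathrm dD]\wedge[\mathrm dG_1].$$ (b) (Real symmetric case.) Let $\lambda_1>\cdots>\lambda_n$ be differentiable real functions on $\Omega$, $D=\mathrm{diag}(\lambda_1,\ldots,\lambda_n)$, let $V:\Omega\to\mathcal O(n)$ be a differentiable function whose values are real orthogonal matrices, and let $X=VDV^{T}$ (so that $X$ is real symmetric with distinct eigenvalues). Put $\mathrm dG=V^{T}\mathrm dV$ and $$[\mathrm dX]=\bigwedge_{i\ge j}\mathrm dx_{ij},\qquad [\mathrm dD]=\bigwedge_j\mathrm d\lambda_j,\qquad [\mathrm dG]=\bigwedge_{i<j}(V^{T}\mathrm dV)_{ij}.$$ Then at every point of $\Omega$, up to sign, $$[\mathrm dX]=\Big(\prod_{i<j}|\lambda_i-\lambda_j|\Big)\,[\mathrm dD]\wedge[\mathrm dG].$$ -/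

import Mathlib

/-- The wedge product `⋀_{a ∈ ι} θ_a` of a family of (constant) real 1-forms on `E`, i.e. the
alternating form `(v_a)_a ↦ det (θ_a (v_b))_{b, a}`. -/
noncomputable def wedge {ι : Type*} [Fintype ι] [DecidableEq ι] {E : Type*} [AddCommGroup E]
    [Module ℝ E] (θ : ι → E →ₗ[ℝ] ℝ) : E [⋀^ι]→ₗ[ℝ] ℝ :=
  (Matrix.detRowAlternating (R := ℝ) (n := ι)).compLinearMap (LinearMap.pi θ)

/-- Equality of alternating forms with the sign ignored. -/
def EqUpToSign {ι E : Type*} [AddCommGroup E] [Module ℝ E] (ω η : E [⋀^ι]→ₗ[ℝ] ℝ) : Prop :=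
  ω = η ∨ ω = -η

/-- The index pairs `(i, j)` with `i < j`. -/
abbrev LtPair (n : ℕ) : Type := {q : Fin n × Fin n // q.1 < q.2}

section Forms

variable {E : Type*} [NormedAddCommGroup E] [NormedSpace ℝ E] {n : ℕ}

/-- The matrix of differentials `dM = [dm_{ij}]` at the parameter `p` of a matrix-valued function
`M`, as a matrix-valued 1-form: it maps a tangent vector `v` to the matrix with entries
`(dm_{ij})_p (v)`. -/
noncomputable def matDiff {𝕜 : Type*} [NormedAddCommGroup 𝕜] [NormedSpace ℝ 𝕜]
    (M : E → Matrix (Fin n) (Fin n) 𝕜) (p : E) : E →ₗ[ℝ] Matrix (Fin n) (Fin n) 𝕜 where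
  toFun v := Matrix.of fun i j => fderiv ℝ (fun q => M q i j) p v
  map_add' v w := by ext i j; simp
  map_smul' c v := by ext i j; simp

/-- The real 1-form `ω_{ij}`, for a real matrix-valued 1-form `ω`. -/
def entryForm (ω : E →ₗ[ℝ] Matrix (Fin n) (Fin n) ℝ) (i j : Fin n) : E →ₗ[ℝ] ℝ :=
  Matrix.entryLinearMap ℝ ℝ i j ∘ₗ ω

/-- The real 1-form `Re ω_{ij}`, for a complex matrix-valued 1-form `ω`. -/
noncomputable def reForm (ω : E →ₗ[ℝ] Matrix (Fin n) (Fin n) ℂ) (i j : Fin n) : E →ₗ[ℝ] ℝ :=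
  Complex.reLm ∘ₗ Matrix.entryLinearMap ℝ ℂ i j ∘ₗ ω

/-- The real 1-form `Im ω_{ij}`, for a complex matrix-valued 1-form `ω`. -/
noncomputable def imForm (ω : E →ₗ[ℝ] Matrix (Fin n) (Fin n) ℂ) (i j : Fin n) : E →ₗ[ℝ] ℝ :=
  Complex.imLm ∘ₗ Matrix.entryLinearMap ℝ ℂ i j ∘ₗ ω

/-- The 1-form `dλ_j` at `p`. -/
noncomputable def eigDiff (lam : E → Fin n → ℝ) (p : E) (j : Fin n) : E →ₗ[ℝ] ℝ :=
  (fderiv ℝ (fun q => lam q j) p : E →ₗ[ℝ] ℝ)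

/-- The matrix-valued 1-form `dG = U* dU` at `p` (it is `Vᵀ dV` for real `V`). -/
noncomputable def maurerCartan {𝕜 : Type*} [RCLike 𝕜]
    (U : E → Matrix (Fin n) (Fin n) 𝕜) (p : E) : E →ₗ[ℝ] Matrix (Fin n) (Fin n) 𝕜 :=
  LinearMap.mulLeft ℝ (U p).conjTranspose ∘ₗ matDiff U p

/-- `[dX] = ∏_j dx_{jj} ∏_{j > k} dRe(x_{jk}) dIm(x_{jk})`, for a Hermitian matrix `X`. -/
noncomputable def volHerm (X : E → Matrix (Fin n) (Fin n) ℂ) (p : E) :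
    E [⋀^(Fin n ⊕ LtPair n ⊕ LtPair n)]→ₗ[ℝ] ℝ :=
  wedge (Sum.elim (fun j => reForm (matDiff X p) j j)
    (Sum.elim (fun q => reForm (matDiff X p) q.1.2 q.1.1)
      (fun q => imForm (matDiff X p) q.1.2 q.1.1)))

/-- `[dD] ∧ [dG₁]`, where `[dD] = ∏_j dλ_j` and
`[dG₁] = ∏_{i < j} Re(U* dU)_{ij} Im(U* dU)_{ij}`. -/
noncomputable def volEigUnitary (lam : E → Fin n → ℝ) (U : E → Matrix (Fin n) (Fin n) ℂ) (p : E) :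
    E [⋀^(Fin n ⊕ LtPair n ⊕ LtPair n)]→ₗ[ℝ] ℝ :=
  wedge (Sum.elim (fun j => eigDiff lam p j)
    (Sum.elim (fun q => reForm (maurerCartan U p) q.1.1 q.1.2)
      (fun q => imForm (maurerCartan U p) q.1.1 q.1.2)))

/-- `[dX] = ∏_{i ≥ j} dx_{ij}`, for a real symmetric matrix `X`. -/
noncomputable def volSymm (X : E → Matrix (Fin n) (Fin n) ℝ) (p : E) :
    E [⋀^(Fin n ⊕ LtPair n)]→ₗ[ℝ] ℝ :=
  wedge (Sum.elim (fun j => entryForm (matDiff X p) j j)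
    (fun q => entryForm (matDiff X p) q.1.2 q.1.1))

/-- `[dD] ∧ [dG]`, where `[dD] = ∏_j dλ_j` and `[dG] = ∏_{i < j} (Vᵀ dV)_{ij}`. -/
noncomputable def volEigOrthogonal (lam : E → Fin n → ℝ) (V : E → Matrix (Fin n) (Fin n) ℝ)
    (p : E) : E [⋀^(Fin n ⊕ LtPair n)]→ₗ[ℝ] ℝ :=
  wedge (Sum.elim (fun j => eigDiff lam p j)
    (fun q => entryForm (maurerCartan V p) q.1.1 q.1.2))

end Forms

/-! Differentiating X = U D U* and writing dU = U dG gives dX = U K U* with K = dD + dG D - D dG.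
Since U*U = 1, dG is skew-Hermitian and K is Hermitian. The commutator with D kills the diagonal, so
K_jj = dλ_j, while for i ≠ j the entry K_ji is -(λ_i - λ_j) times the conjugate of dG_ij: in the
moving frame each coordinate of K is a multiple of one form on the right-hand side. It remains to
discard the outer U. Conjugation by U preserves Re tr(A*A) on Hermitian matrices, so its determinant
in any linear coordinates is ±1 (`abs_det_unitary_conj`). Both cases share this argument over
`RCLike`; a pair i < j carries two coordinates in the Hermitian case, whence the square, and one in
the symmetric case. -/

/-- Equality up to sign of two multiples of the same form. -/
theorem EqUpToSign.of_abs_eq {ι E : Type*} [AddCommGroup E] [Module ℝ E]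
    {ω : E [⋀^ι]→ₗ[ℝ] ℝ} {a b : ℝ} (h : |a| = |b|) : EqUpToSign (a • ω) (b • ω) := by
  rcases abs_eq_abs.1 h with rfl | rfl
  · exact Or.inl rfl
  · exact Or.inr (AlternatingMap.ext fun v => by simp)

/-! ### Wedge products under linear changes of the forms -/

section Wedge

variable {ι : Type*} [Fintype ι] [DecidableEq ι] {E : Type*} [AddCommGroup E] [Module ℝ E]

theorem wedge_apply (θ : ι → E →ₗ[ℝ] ℝ) (v : ι → E) :
    wedge θ v = (Matrix.of fun b a => θ a (v b)).det := rfl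

/-- A linear change of the coefficients multiplies the wedge product by the determinant. -/
theorem wedge_eq_det_smul (P : (ι → ℝ) →ₗ[ℝ] ι → ℝ) (θ η : ι → E →ₗ[ℝ] ℝ)
    (h : ∀ v a, θ a v = P (fun b => η b v) a) : wedge θ = LinearMap.det P • wedge η := by
  ext v
  have : (Matrix.of fun b a => θ a (v b)) =
      (Matrix.of fun b a => η a (v b)) * (LinearMap.toMatrix' P).transpose := by
    ext b a
    have := congrFun (LinearMap.toMatrix'_mulVec P (fun c => η c (v b))) a
    simp only [Matrix.of_apply, h, ← this, Matrix.mul_apply, Matrix.mulVec, dotProduct,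
      Matrix.transpose_apply]
    exact Finset.sum_congr rfl fun c _ => mul_comm _ _
  rw [AlternatingMap.smul_apply, wedge_apply, wedge_apply, this, Matrix.det_mul,
    Matrix.det_transpose, LinearMap.det_toMatrix', smul_eq_mul, mul_comm]

theorem wedge_eq_prod_smul (s : ι → ℝ) (θ η : ι → E →ₗ[ℝ] ℝ)
    (h : ∀ v a, θ a v = s a * η a v) : wedge θ = (∏ a, s a) • wedge η := by
  have := wedge_eq_det_smul (Matrix.toLin' (Matrix.diagonal s)) θ η
    fun v a => by simp [Matrix.mulVec_diagonal, h]
  simpa using this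

end Wedge

/-- A linear map preserving a positive definite quadratic form has determinant `±1`. -/
theorem QuadraticForm.PosDef.abs_det_eq_one {ι : Type*} [Fintype ι] [DecidableEq ι]
    {Q : QuadraticForm ℝ (ι → ℝ)} (hQ : QuadraticMap.PosDef Q) (P : (ι → ℝ) →ₗ[ℝ] ι → ℝ)
    (h : ∀ c, Q (P c) = Q c) : |LinearMap.det P| = 1 := by
  have hc : Q.comp P = Q := QuadraticMap.ext h
  have hd : Q.discr' ≠ 0 := (QuadraticForm.posDef_toMatrix' hQ).det_pos.ne'
  -- The discriminant of Q ∘ P is det(P)² times that of Q, which is nonzero and cancels.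
  have := QuadraticForm.discr'_comp (Q := Q) P
  rw [hc, LinearMap.det_toMatrix'] at this
  have h1 : LinearMap.det P * LinearMap.det P = 1 :=
    mul_right_cancel₀ hd (by rw [← this, one_mul])
  exact abs_eq (zero_le_one' ℝ) |>.2 (mul_self_eq_one_iff.1 h1)

/-! ### Unitary conjugation has determinant ±1 -/

section Conjugation

open Matrix

variable {ι 𝕜 : Type*} [Fintype ι] [DecidableEq ι] [RCLike 𝕜] {n : ℕ}

open scoped ComplexOrder in
/-- Conjugation by a unitary matrix, read in coordinates of a space of matrices, has determinant
`±1`. -/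
theorem abs_det_unitary_conj (f : (ι → ℝ) →ₗ[ℝ] Matrix (Fin n) (Fin n) 𝕜)
    (hf : Function.Injective f) (P : (ι → ℝ) →ₗ[ℝ] ι → ℝ) {U : Matrix (Fin n) (Fin n) 𝕜}
    (hU : Uᴴ * U = 1) (hP : ∀ c, f (P c) = U * f c * Uᴴ) : |LinearMap.det P| = 1 := by
  -- The Frobenius inner product pulled back along `f`. For Hermitian coordinates it counts
  -- off-diagonal entries twice, so it is not the standard one and `P` need not be an orthogonal
  -- matrix.
  let B : LinearMap.BilinForm ℝ (ι → ℝ) := LinearMap.mk₂ ℝ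
    (fun c d => RCLike.re (trace ((f c)ᴴ * f d)))
    (fun _ _ _ => by simp [add_mul]) (fun _ _ _ => by simp [RCLike.smul_re])
    (fun _ _ _ => by simp [mul_add]) (fun _ _ _ => by simp [RCLike.smul_re])
  have hB (c) : B.toQuadraticMap c = RCLike.re (trace ((f c)ᴴ * f c)) := rfl
  refine QuadraticForm.PosDef.abs_det_eq_one (Q := B.toQuadraticMap) (fun c hc => ?_) P fun c => ?_
  · have hfc : f c ≠ 0 := fun h => hc (hf (h.trans (map_zero f).symm))
    have h0 : 0 ≤ trace ((f c)ᴴ * f c) := (posSemidef_conjTranspose_mul_self (f c)).trace_nonneg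
    exact (RCLike.pos_iff.1 (h0.lt_of_ne' (mt trace_conjTranspose_mul_self_eq_zero_iff.1 hfc))).1
  · rw [hB, hB, hP, conjTranspose_mul, conjTranspose_mul, conjTranspose_conjTranspose]
    have : U * ((f c)ᴴ * Uᴴ) * (U * f c * Uᴴ) = U * ((f c)ᴴ * f c * Uᴴ) := by
      simp only [mul_assoc]
      rw [← mul_assoc Uᴴ U, hU, one_mul]
    rw [this, trace_mul_comm, mul_assoc, hU, mul_one]

/-- The wedge product of the coordinates of a Hermitian-matrix-valued 1-form is invariant, up to
sign, under unitary conjugation. -/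
theorem wedge_coord_unitary_conj {E : Type*} [AddCommGroup E] [Module ℝ E]
    (f : (ι → ℝ) →ₗ[ℝ] Matrix (Fin n) (Fin n) 𝕜) (g : Matrix (Fin n) (Fin n) 𝕜 →ₗ[ℝ] ι → ℝ)
    (hf : ∀ c, (f c).IsHermitian) (hgf : ∀ c, g (f c) = c) (hfg : ∀ A, A.IsHermitian → f (g A) = A)
    {U : Matrix (Fin n) (Fin n) 𝕜} (hU : Uᴴ * U = 1) (K : E → Matrix (Fin n) (Fin n) 𝕜)
    (hK : ∀ v, (K v).IsHermitian) (s : ι → ℝ) (θ η : ι → E →ₗ[ℝ] ℝ)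
    (hθ : ∀ v a, θ a v = g (U * K v * Uᴴ) a) (hη : ∀ v a, g (K v) a = s a * η a v)
    {r : ℝ} (hr : |r| = ∏ a, |s a|) : EqUpToSign (wedge θ) (r • wedge η) := by
  let P : (ι → ℝ) →ₗ[ℝ] ι → ℝ :=
    g ∘ₗ LinearMap.mulRight ℝ Uᴴ ∘ₗ LinearMap.mulLeft ℝ U ∘ₗ f
  have hP (c) : P c = g (U * f c * Uᴴ) := rfl
  have hdet : |LinearMap.det P| = 1 := by
    refine abs_det_unitary_conj f (Function.LeftInverse.injective hgf) P hU fun c => ?_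
    rw [hP, hfg]
    exact isHermitian_mul_mul_conjTranspose U (hf c)
  -- The forms `s a • η a` are the coordinates of `K`, so `P` alone carries them to `θ`; the factors
  -- `s` are extracted afterwards.
  have h1 := wedge_eq_det_smul P θ (fun a => s a • η a) fun v a => by
    have : (fun b => (s b • η b) v) = g (K v) := by
      ext b; simp [hη]
    rw [this, hP, hfg _ (hK v), hθ]
  rw [h1, wedge_eq_prod_smul s _ η fun v a => rfl, smul_smul]
  apply EqUpToSign.of_abs_eq
  rw [abs_mul, hdet, one_mul, hr, Finset.abs_prod]

end Conjugation

/-! ### The differential of U D U* in the moving frame -/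

section Differentials

open Matrix

variable {𝕜 E : Type*} [RCLike 𝕜] [NormedAddCommGroup E] [NormedSpace ℝ E] {n : ℕ} {p : E}

theorem matDiff_congr {M N : E → Matrix (Fin n) (Fin n) 𝕜} (h : M =ᶠ[nhds p] N) :
    matDiff M p = matDiff N p := by
  ext v i j
  have : (fun q => M q i j) =ᶠ[nhds p] fun q => N q i j := h.mono fun q hq => by simp [hq]
  simp [matDiff, this.fderiv_eq]

theorem matDiff_const (A : Matrix (Fin n) (Fin n) 𝕜) : matDiff (fun _ : E => A) p = 0 := by
  ext v i j
  simp [matDiff]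

theorem matDiff_mul {M N : E → Matrix (Fin n) (Fin n) 𝕜}
    (hM : ∀ i j, DifferentiableAt ℝ (fun q => M q i j) p)
    (hN : ∀ i j, DifferentiableAt ℝ (fun q => N q i j) p) (v : E) :
    matDiff (fun q => M q * N q) p v = matDiff M p v * N p + M p * matDiff N p v := by
  ext i j
  simp only [matDiff, LinearMap.coe_mk, AddHom.coe_mk, of_apply, mul_apply, Matrix.add_apply]
  rw [fderiv_fun_sum (A := fun k q => M q i k * N q k j) fun k _ => (hM i k).mul (hN k j), _root_.sum_apply,
    ← Finset.sum_add_distrib]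
  refine Finset.sum_congr rfl fun k _ => ?_
  rw [fderiv_fun_mul (hM i k) (hN k j)]
  simp [mul_comm, add_comm]

theorem matDiff_conjTranspose (M : E → Matrix (Fin n) (Fin n) 𝕜)
    (hM : ∀ i j, DifferentiableAt ℝ (fun q => M q i j) p) (v : E) :
    matDiff (fun q => (M q)ᴴ) p v = (matDiff M p v)ᴴ := by
  ext i j
  have := ((RCLike.conjCLE (K := 𝕜)).toContinuousLinearMap.hasFDerivAt.comp p
    (hM j i).hasFDerivAt).fderiv
  change fderiv ℝ (fun q => star (M q j i)) p v = star (fderiv ℝ (fun q => M q j i) p v)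
  exact congrArg (fun L => L v) this

theorem matDiff_diagonal {lam : E → Fin n → ℝ}
    (hl : ∀ j, DifferentiableAt ℝ (fun q => lam q j) p) (v : E) :
    matDiff (fun q => diagonal fun j => (lam q j : 𝕜)) p v =
      diagonal fun j => (eigDiff lam p j v : 𝕜) := by
  ext i j
  by_cases h : i = j
  · subst h
    have := ((RCLike.ofRealCLM (K := 𝕜)).hasFDerivAt.comp p (hl i).hasFDerivAt).fderiv
    simp only [matDiff, LinearMap.coe_mk, AddHom.coe_mk, of_apply, diagonal_apply_eq]
    exact congrArg (fun L => L v) this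
  · simp [matDiff, h]

theorem differentiableAt_conjTranspose {M : E → Matrix (Fin n) (Fin n) 𝕜}
    (hM : ∀ i j, DifferentiableAt ℝ (fun q => M q i j) p) (i j : Fin n) :
    DifferentiableAt ℝ (fun q => (M q)ᴴ i j) p :=
  (RCLike.conjCLE (K := 𝕜)).toContinuousLinearMap.differentiableAt.comp p (hM j i)

theorem differentiableAt_diagonal {lam : E → Fin n → ℝ}
    (hl : ∀ j, DifferentiableAt ℝ (fun q => lam q j) p) (i j : Fin n) :
    DifferentiableAt ℝ (fun q => diagonal (fun j => (lam q j : 𝕜)) i j) p := by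
  by_cases h : i = j
  · subst h
    simp only [diagonal_apply_eq]
    exact (RCLike.ofRealCLM (K := 𝕜)).differentiableAt.comp p (hl i)
  · simp [h]

theorem differentiableAt_matrix_mul {M N : E → Matrix (Fin n) (Fin n) 𝕜}
    (hM : ∀ i j, DifferentiableAt ℝ (fun q => M q i j) p)
    (hN : ∀ i j, DifferentiableAt ℝ (fun q => N q i j) p) (i j : Fin n) :
    DifferentiableAt ℝ (fun q => (M q * N q) i j) p := by
  simp only [mul_apply]
  exact DifferentiableAt.fun_sum fun k _ => (hM i k).mul (hN k j)

/-- The Maurer-Cartan form of a unitary-matrix-valued function is skew-Hermitian. -/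
theorem conjTranspose_maurerCartan {U : E → Matrix (Fin n) (Fin n) 𝕜}
    (hU : ∀ i j, DifferentiableAt ℝ (fun q => U q i j) p) (h : ∀ᶠ q in nhds p, (U q)ᴴ * U q = 1)
    (v : E) : (maurerCartan U p v)ᴴ = -maurerCartan U p v := by
  -- Differentiate the constant U*U = 1.
  have h1 : matDiff (fun q => (U q)ᴴ * U q) p v = 0 := by
    rw [matDiff_congr (N := fun _ => 1) h, matDiff_const, LinearMap.zero_apply]
  rw [matDiff_mul (differentiableAt_conjTranspose hU) hU, matDiff_conjTranspose U hU] at h1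
  change ((U p)ᴴ * matDiff U p v)ᴴ = -((U p)ᴴ * matDiff U p v)
  rw [conjTranspose_mul, conjTranspose_conjTranspose]
  exact eq_neg_of_add_eq_zero_left h1

/-- The matrix-valued 1-form `dD + dG D - D dG` with `D = diag(λ)` and `dG = U* dU`. -/
noncomputable def eigFrameDiff (lam : E → Fin n → ℝ) (U : E → Matrix (Fin n) (Fin n) 𝕜) (p v : E) :
    Matrix (Fin n) (Fin n) 𝕜 :=
  diagonal (fun j => (eigDiff lam p j v : 𝕜)) +
    (maurerCartan U p v * diagonal (fun j => (lam p j : 𝕜)) -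
      diagonal (fun j => (lam p j : 𝕜)) * maurerCartan U p v)

/-- The commutator of a skew-Hermitian matrix with a Hermitian one is Hermitian. -/
theorem isHermitian_eigFrameDiff {lam : E → Fin n → ℝ} {U : E → Matrix (Fin n) (Fin n) 𝕜}
    (hU : ∀ i j, DifferentiableAt ℝ (fun q => U q i j) p) (h : ∀ᶠ q in nhds p, (U q)ᴴ * U q = 1)
    (v : E) : (eigFrameDiff lam U p v).IsHermitian := by
  have hd (c : Fin n → ℝ) : (diagonal fun j => (c j : 𝕜))ᴴ = diagonal fun j => (c j : 𝕜) := by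
    rw [diagonal_conjTranspose]; congr 1; ext j; simp
  rw [IsHermitian, eigFrameDiff, conjTranspose_add, conjTranspose_sub, conjTranspose_mul,
    conjTranspose_mul, conjTranspose_maurerCartan hU h, hd, hd]
  noncomm_ring

theorem eigFrameDiff_apply_self (lam : E → Fin n → ℝ) (U : E → Matrix (Fin n) (Fin n) 𝕜) (p v : E)
    (j : Fin n) : eigFrameDiff lam U p v j j = (eigDiff lam p j v : 𝕜) := by
  simp [eigFrameDiff, mul_comm]

/-- Skewness of dG is used to swap indices: [dX] uses entries below the diagonal, [dG] those above.
-/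
theorem eigFrameDiff_apply_of_ne {lam : E → Fin n → ℝ} {U : E → Matrix (Fin n) (Fin n) 𝕜}
    (hU : ∀ i j, DifferentiableAt ℝ (fun q => U q i j) p) (h : ∀ᶠ q in nhds p, (U q)ᴴ * U q = 1)
    (v : E) {i j : Fin n} (hij : i ≠ j) : eigFrameDiff lam U p v j i =
      ((-(lam p i - lam p j) : ℝ) : 𝕜) * star (maurerCartan U p v i j) := by
  have hG : star (maurerCartan U p v i j) = -maurerCartan U p v j i := by
    rw [← conjTranspose_apply, conjTranspose_maurerCartan hU h, neg_apply]
  rw [hG]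
  simp only [eigFrameDiff, Matrix.add_apply, Matrix.sub_apply, diagonal_apply_ne _ hij.symm, mul_diagonal,
    diagonal_mul]
  push_cast
  ring

/-- The differential of `X = U D U*` in the moving frame `U`. -/
theorem matDiff_eq_conj_eigFrameDiff {lam : E → Fin n → ℝ} {X U : E → Matrix (Fin n) (Fin n) 𝕜}
    (hl : ∀ j, DifferentiableAt ℝ (fun q => lam q j) p)
    (hU : ∀ i j, DifferentiableAt ℝ (fun q => U q i j) p) (h : ∀ᶠ q in nhds p, (U q)ᴴ * U q = 1)
    (hX : ∀ᶠ q in nhds p, X q = U q * diagonal (fun j => (lam q j : 𝕜)) * (U q)ᴴ) (v : E) :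
    matDiff X p v = U p * eigFrameDiff lam U p v * (U p)ᴴ := by
  rw [matDiff_congr hX, matDiff_mul
    (differentiableAt_matrix_mul hU (differentiableAt_diagonal hl))
    (differentiableAt_conjTranspose hU), matDiff_mul hU (differentiableAt_diagonal hl),
    matDiff_diagonal hl, matDiff_conjTranspose U hU]
  have hUp : U p * (U p)ᴴ = 1 := mul_eq_one_comm.1 h.self_of_nhds
  have hdU : matDiff U p v = U p * maurerCartan U p v := by
    change _ = U p * ((U p)ᴴ * matDiff U p v)
    rw [← mul_assoc, hUp, one_mul]
  rw [hdU, conjTranspose_mul, conjTranspose_maurerCartan hU h, eigFrameDiff]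
  noncomm_ring

end Differentials

/-! ### Real coordinates on Hermitian and symmetric matrices -/

section Coordinates

open Matrix

variable {n : ℕ}

/-- The Hermitian matrix with given diagonal entries and given real and imaginary parts of the
entries below the diagonal. -/
noncomputable def hermOfCoord (n : ℕ) :
    (Fin n ⊕ LtPair n ⊕ LtPair n → ℝ) →ₗ[ℝ] Matrix (Fin n) (Fin n) ℂ where
  toFun c := Matrix.of fun i j =>
    if h : j < i then ⟨c (.inr (.inl ⟨(j, i), h⟩)), c (.inr (.inr ⟨(j, i), h⟩))⟩
    else if h : i < j then ⟨c (.inr (.inl ⟨(i, j), h⟩)), -c (.inr (.inr ⟨(i, j), h⟩))⟩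
    else (c (.inl i) : ℂ)
  map_add' c d := by
    ext i j
    simp only [of_apply, Matrix.add_apply]
    split_ifs <;> simp [Complex.ext_iff, add_comm]
  map_smul' r c := by
    ext i j
    simp only [of_apply, Matrix.smul_apply]
    split_ifs <;> simp [Complex.ext_iff]

/-- The diagonal entries and the real and imaginary parts of the entries below the diagonal. -/
noncomputable def hermCoord (n : ℕ) :
    Matrix (Fin n) (Fin n) ℂ →ₗ[ℝ] Fin n ⊕ LtPair n ⊕ LtPair n → ℝ :=
  LinearMap.pi (Sum.elim (fun j => Complex.reLm ∘ₗ entryLinearMap ℝ ℂ j j)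
    (Sum.elim (fun q => Complex.reLm ∘ₗ entryLinearMap ℝ ℂ q.1.2 q.1.1)
      (fun q => Complex.imLm ∘ₗ entryLinearMap ℝ ℂ q.1.2 q.1.1)))

theorem isHermitian_hermOfCoord (c) : (hermOfCoord n c).IsHermitian := by
  ext i j
  rcases lt_trichotomy i j with h | rfl | h
  · apply Complex.ext <;> simp [hermOfCoord, h, h.not_gt]
  · apply Complex.ext <;> simp [hermOfCoord]
  · apply Complex.ext <;> simp [hermOfCoord, h, h.not_gt]

theorem hermCoord_hermOfCoord (c) : hermCoord n (hermOfCoord n c) = c := by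
  ext (j | ⟨q, hq⟩ | ⟨q, hq⟩)
  · simp [hermCoord, hermOfCoord]
  · simp [hermCoord, hermOfCoord, hq]
  · simp [hermCoord, hermOfCoord, hq]

theorem hermOfCoord_hermCoord (A : Matrix (Fin n) (Fin n) ℂ) (hA : A.IsHermitian) :
    hermOfCoord n (hermCoord n A) = A := by
  ext i j
  have hij := hA.apply i j
  rcases lt_trichotomy i j with h | rfl | h
  · rw [← hij]
    apply Complex.ext <;> simp [hermOfCoord, hermCoord, h, h.not_gt]
  · have := Complex.ext_iff.1 hij
    have : (A i i).im = 0 := by simp at this; linarith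
    apply Complex.ext <;> simp [hermOfCoord, hermCoord, this]
  · apply Complex.ext <;> simp [hermOfCoord, hermCoord, h]

/-- The symmetric matrix with given entries on and below the diagonal. -/
def symmOfCoord (n : ℕ) : (Fin n ⊕ LtPair n → ℝ) →ₗ[ℝ] Matrix (Fin n) (Fin n) ℝ where
  toFun c := Matrix.of fun i j =>
    if h : j < i then c (.inr ⟨(j, i), h⟩)
    else if h : i < j then c (.inr ⟨(i, j), h⟩)
    else c (.inl i)
  map_add' c d := by
    ext i j
    simp only [of_apply, Matrix.add_apply]
    split_ifs <;> simp
  map_smul' r c := by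
    ext i j
    simp only [of_apply, Matrix.smul_apply]
    split_ifs <;> simp

/-- The entries on and below the diagonal. -/
def symmCoord (n : ℕ) : Matrix (Fin n) (Fin n) ℝ →ₗ[ℝ] Fin n ⊕ LtPair n → ℝ :=
  LinearMap.pi (Sum.elim (fun j => entryLinearMap ℝ ℝ j j)
    (fun q => entryLinearMap ℝ ℝ q.1.2 q.1.1))

theorem isHermitian_symmOfCoord (c) : (symmOfCoord n c).IsHermitian := by
  ext i j
  rcases lt_trichotomy i j with h | rfl | h
  · simp [symmOfCoord, h, h.not_gt]
  · simp [symmOfCoord]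
  · simp [symmOfCoord, h, h.not_gt]

theorem symmCoord_symmOfCoord (c) : symmCoord n (symmOfCoord n c) = c := by
  ext (j | ⟨q, hq⟩)
  · simp [symmCoord, symmOfCoord]
  · simp [symmCoord, symmOfCoord, hq]

theorem symmOfCoord_symmCoord (A : Matrix (Fin n) (Fin n) ℝ) (hA : A.IsHermitian) :
    symmOfCoord n (symmCoord n A) = A := by
  ext i j
  have hij := hA.apply i j
  rcases lt_trichotomy i j with h | rfl | h
  · rw [← hij]
    simp [symmOfCoord, symmCoord, h, h.not_gt]
  · simp [symmOfCoord, symmCoord]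
  · simp [symmOfCoord, symmCoord, h]

theorem prod_ltPair (f : Fin n → Fin n → ℝ) :
    ∏ q : LtPair n, f q.1.1 q.1.2 = ∏ j : Fin n, ∏ i ∈ Finset.Iio j, f i j := by
  rw [Finset.prod_sigma']
  refine Finset.prod_bij (fun q _ => ⟨q.1.2, q.1.1⟩) (fun q _ => by simp [q.2]) ?_ ?_ fun _ _ => rfl
  · rintro ⟨⟨a, b⟩, h⟩ _ ⟨⟨c, d⟩, h'⟩ _ e
    simp_all
  · rintro ⟨j, i⟩ h
    exact ⟨⟨(i, j), by simpa using h⟩, Finset.mem_univ _, rfl⟩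

end Coordinates

/-! ### The two cases -/

theorem mainTheorem8 {E : Type*} [NormedAddCommGroup E] [NormedSpace ℝ E] (n : ℕ)
    (Ω : Set E) (hΩ : IsOpen Ω) :
    (∀ (X U : E → Matrix (Fin n) (Fin n) ℂ) (lam : E → Fin n → ℝ),
      (∀ j, DifferentiableOn ℝ (fun p => lam p j) Ω) →
      (∀ i j, DifferentiableOn ℝ (fun p => U p i j) Ω) →
      (∀ p ∈ Ω, StrictAnti (lam p)) →
      (∀ p ∈ Ω, U p ∈ Matrix.unitaryGroup (Fin n) ℂ) →
      (∀ p ∈ Ω, ∀ j, (U p j j).im = 0) →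
      (∀ p ∈ Ω, X p =
        U p * Matrix.diagonal (fun j => (lam p j : ℂ)) * (U p).conjTranspose) →
      ∀ p ∈ Ω, EqUpToSign (volHerm X p)
        ((∏ j : Fin n, ∏ k ∈ Finset.Iio j, |lam p k - lam p j| ^ 2) • volEigUnitary lam U p)) ∧
    (∀ (X V : E → Matrix (Fin n) (Fin n) ℝ) (lam : E → Fin n → ℝ),
      (∀ j, DifferentiableOn ℝ (fun p => lam p j) Ω) →
      (∀ i j, DifferentiableOn ℝ (fun p => V p i j) Ω) →
      (∀ p ∈ Ω, StrictAnti (lam p)) →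
      (∀ p ∈ Ω, V p ∈ Matrix.orthogonalGroup (Fin n) ℝ) →
      (∀ p ∈ Ω, X p = V p * Matrix.diagonal (lam p) * (V p).transpose) →
      ∀ p ∈ Ω, EqUpToSign (volSymm X p)
        ((∏ j : Fin n, ∏ i ∈ Finset.Iio j, |lam p i - lam p j|) • volEigOrthogonal lam V p)) := by
  constructor
  · intro X U lam hl hU _ hUu _ hX p hp
    have hΩp := hΩ.mem_nhds hp
    have hU' (i j) : DifferentiableAt ℝ (fun q => U q i j) p := (hU i j).differentiableAt hΩp
    have hl' (j) : DifferentiableAt ℝ (fun q => lam q j) p := (hl j).differentiableAt hΩp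
    have hUn : ∀ᶠ q in nhds p, (U q).conjTranspose * U q = 1 :=
      Filter.eventually_of_mem hΩp fun q hq => Matrix.mem_unitaryGroup_iff'.1 (hUu q hq)
    have hdX := matDiff_eq_conj_eigFrameDiff hl' hU' hUn (Filter.eventually_of_mem hΩp hX)
    refine wedge_coord_unitary_conj (hermOfCoord n) (hermCoord n) isHermitian_hermOfCoord
      hermCoord_hermOfCoord hermOfCoord_hermCoord hUn.self_of_nhds (eigFrameDiff lam U p)
      (isHermitian_eigFrameDiff hU' hUn)
      -- Conjugating dG_ij flips the sign of its imaginary part, so the two blocks of factors have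
      -- opposite signs.
      (Sum.elim (fun _ => 1) (Sum.elim (fun q => -(lam p q.1.1 - lam p q.1.2))
        (fun q => lam p q.1.1 - lam p q.1.2))) _ _ ?_ ?_ ?_
    · rintro v (j | q | q) <;> rw [← hdX] <;> rfl
    · rintro v (j | q | q)
      · simp [hermCoord, eigFrameDiff_apply_self]
      · simp [hermCoord, eigFrameDiff_apply_of_ne hU' hUn v q.2.ne, reForm]
      · simp [hermCoord, eigFrameDiff_apply_of_ne hU' hUn v q.2.ne, imForm]
        ring
    -- The real and imaginary blocks contribute the same absolute value, which gives the square.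
    · rw [← prod_ltPair (fun i j => |lam p i - lam p j| ^ 2)]
      simp only [Fintype.prod_sum_type, Sum.elim_inl, Sum.elim_inr, abs_neg, abs_one,
        Finset.prod_const_one, one_mul, ← pow_two, Finset.prod_pow, abs_pow, Finset.abs_prod,
        abs_abs]
  · intro X V lam hl hV _ hVu hX p hp
    have hΩp := hΩ.mem_nhds hp
    have hV' (i j) : DifferentiableAt ℝ (fun q => V q i j) p := (hV i j).differentiableAt hΩp
    have hl' (j) : DifferentiableAt ℝ (fun q => lam q j) p := (hl j).differentiableAt hΩp
    have hVn : ∀ᶠ q in nhds p, (V q).conjTranspose * V q = 1 :=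
      Filter.eventually_of_mem hΩp fun q hq => Matrix.mem_unitaryGroup_iff'.1 (hVu q hq)
    have hdX := matDiff_eq_conj_eigFrameDiff (X := X) hl' hV' hVn
      (Filter.eventually_of_mem hΩp fun q hq => by
        rw [Matrix.conjTranspose_eq_transpose_of_trivial]; exact hX q hq)
    refine wedge_coord_unitary_conj (symmOfCoord n) (symmCoord n) isHermitian_symmOfCoord
      symmCoord_symmOfCoord symmOfCoord_symmCoord hVn.self_of_nhds (eigFrameDiff lam V p)
      (isHermitian_eigFrameDiff hV' hVn)
      (Sum.elim (fun _ => 1) (fun q => -(lam p q.1.1 - lam p q.1.2))) _ _ ?_ ?_ ?_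
    · rintro v (j | q) <;> rw [← hdX] <;> rfl
    · rintro v (j | q)
      · simp [symmCoord, eigFrameDiff_apply_self]
      · simp [symmCoord, eigFrameDiff_apply_of_ne hV' hVn v q.2.ne, entryForm]
    · rw [← prod_ltPair (fun i j => |lam p i - lam p j|)]
      simp only [Fintype.prod_sum_type, Sum.elim_inl, Sum.elim_inr, abs_neg, abs_one,
        Finset.prod_const_one, one_mul, Finset.abs_prod, abs_abs]
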